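/- Let $n\ge 2$, $h>0$, let $x_i=x_1+(i-1)h$ for $i\ge 1$ be equally spaced points, and let $J=[a,b]$ be a finite interval containing the nodes $x_1,\dots,x_n$. Write $I(f)=\int_{x_1}^{x_n}f(x)\,dx$, let $w_0=1$ and $w_k(x)=(x-x_1)(x-x_2)\cdots(x-x_k)$ for $k\ge 1$ be Newton's polynomials, and let $f[x_i,\dots,x_j]$ denote divided differences. Let $S_n$ be a quadrature rule of one of the two forms $$\text{(model A)}\quad S_n(f)=a_1 f(x_1)+a_2 f[x_1,x_2]+\cdots+a_n f[x_1,\dots,x_n],$$ $$\text{(model B)}\quad S_n(f)=a_1 f(x_1)+\cdots+a_{n-1}f(x_{n-1})+a_n f[x_1,\dots,x_n],$$ with real weights $a_1,\dots,a_n$, independent of $f$, determined by the requirement that $S_n(p)=I(p)$ for every real polynomial $p$ of degree at most $n-1$. Let $\deg S_n$ be the largest integer $d$ such that $S_n(p)=I(p)$ for all real polynomials $p$ of degree at most $d$. Then: (i) If $n$ is odd, then $\deg S_n=n$, and for every $f\in C^{n+1}(J)$ there is $\xi\in J$ with $$I(f)-S_n(f)=\frac{I(w_{n+1})}{(n+1)!}\,f^{(n+1)}(\xi).$$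 (ii) If $n$ is even, then $\deg S_n=n-1$, and for every $f\in C^{n}(J)$ there is $\xi\in J$ with $$I(f)-S_n(f)=\frac{I(w_n)}{n!}\,f^{(n)}(\xi).$$ -/

import Mathlib

open Polynomial

/-- The `i`-th node (counted from `0`) of a panel with first node `x₁` and constant step `h`. -/
def node (x₁ h : ℝ) (i : ℕ) : ℝ := x₁ + i * h

/-- Divided differences of `f` at consecutive nodes: `dividedDiff x f k i` is
`f[x i, x (i+1), …, x (i+k)]`, defined by the usual recursion. -/
noncomputable def dividedDiff (x : ℕ → ℝ) (f : ℝ → ℝ) : ℕ → ℕ → ℝ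
  | 0, i => f (x i)
  | k + 1, i => (dividedDiff x f k (i + 1) - dividedDiff x f k i) / (x (i + k + 1) - x i)

/-- Newton's polynomials `w₀ = 1`, `w_{k+1}(t) = w_k(t) (t - x k)`, with nodes counted from `0`;
so `w_k` has degree `k` and vanishes at the first `k` nodes. -/
noncomputable def newtonPoly (x : ℕ → ℝ) : ℕ → ℝ[X]
  | 0 => 1
  | k + 1 => newtonPoly x k * (X - C (x k))

/-- `I(f)`: the integral of `f` over the panel with nodes `x 0, …, x (n-1)`. -/
noncomputable def panelIntegral (n : ℕ) (x : ℕ → ℝ) (f : ℝ → ℝ) : ℝ :=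
  ∫ t in (x 0)..(x (n - 1)), f t

/-- The rule `R` integrates exactly all polynomials of degree at most `d` over the panel. -/
def ExactUpTo (n : ℕ) (x : ℕ → ℝ) (R : (ℝ → ℝ) → ℝ) (d : ℕ) : Prop :=
  ∀ p : ℝ[X], p.natDegree ≤ d →
    panelIntegral n x (fun t => p.eval t) = R (fun t => p.eval t)

/-- `deg R = d`: the largest `d` such that `R` is exact on all polynomials of degree at most `d`. -/
def HasDegreeOfPrecision (n : ℕ) (x : ℕ → ℝ) (R : (ℝ → ℝ) → ℝ) (d : ℕ) : Prop :=
  IsGreatest {m : ℕ | ExactUpTo n x R m} d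

/-- `S` is the rule of model A on the nodes `x 0, …, x (n-1)`: a combination of the divided
differences `f[x 0], f[x 0, x 1], …, f[x 0, …, x (n-1)]` whose weights are determined by
exactness on the polynomials of degree at most `n - 1`. -/
def IsModelA (n : ℕ) (x : ℕ → ℝ) (S : (ℝ → ℝ) → ℝ) : Prop :=
  (∃ a : ℕ → ℝ, ∀ f : ℝ → ℝ, S f = ∑ j ∈ Finset.range n, a j * dividedDiff x f j 0) ∧
    ExactUpTo n x S (n - 1)

/-- `S` is the rule of model B on the nodes `x 0, …, x (n-1)`: a combination of the values of `f`
at the first `n - 1` nodes and of `f[x 0, …, x (n-1)]`, whose weights are determined by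
exactness on the polynomials of degree at most `n - 1`. -/
def IsModelB (n : ℕ) (x : ℕ → ℝ) (S : (ℝ → ℝ) → ℝ) : Prop :=
  (∃ a : ℕ → ℝ, ∀ f : ℝ → ℝ, S f =
      ∑ j ∈ Finset.range (n - 1), a j * f (x j) + a (n - 1) * dividedDiff x f (n - 1) 0) ∧
    ExactUpTo n x S (n - 1)

open Polynomial MeasureTheory

/-! Either model uses only the nodal values of `f` and is exact in degree `n - 1`, so `S f = I(p)`
for the Lagrange interpolant `p`, and the error is `I(r)` with `r = f - p` vanishing at the nodes.
Put `N = n + 1` for odd `n` and `N = n` for even `n`; thus `N = 2m + 2` in both cases. Everything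
rests on one sign statement: if `r` vanishes at the nodes and its `N`-th derivative is nonnegative,
then `I(r) ≤ 0`. Applied to `r` corrected by multiples of `w_N`, it bounds `I(r)` between values of
`I(w_N)/N! · r^(N)`, and continuity gives `ξ` (`exists_integral_eq_of_nonpos`).

For `n = 2m + 1`, write `r = w_n q`. By Rolle, `q` is nondecreasing (`div_newtonPoly_le`). The
primitive `W` of `w_n` from the first node is nonnegative on the panel and zero at both ends,
because the oscillations of `w_n` shrink towards the middle and `w_n` is odd about it. Hence `I(r) =
-∫ W dq ≤ 0` (`integral_mul_monotone_nonpos`). For `n = 2m + 2`, the odd case covers all but the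
last step, where `r ≤ 0` pointwise.

The same arguments give `I(w_N) < 0`, so exactness fails in degree `N`. -/

/-! ### Rolle's theorem and interpolating polynomials -/

/-- Iterated Rolle theorem on a closed interval. -/
theorem exists_iteratedDerivWithin_eq_zero {a b : ℝ} (hab : a < b) (k : ℕ) :
    ∀ (f : ℝ → ℝ), ContDiffOn ℝ k f (Set.Icc a b) → ∀ t : Fin (k + 1) → ℝ, StrictMono t →
      (∀ i, t i ∈ Set.Icc a b) → (∀ i, f (t i) = 0) →
      ∃ ξ ∈ Set.Icc a b, iteratedDerivWithin k f (Set.Icc a b) ξ = 0 := by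
  have hu := uniqueDiffOn_Icc hab
  induction k with
  | zero =>
    intro f _ t _ ht h0
    exact ⟨t 0, ht 0, by simpa using h0 0⟩
  | succ k ih =>
    intro f hf t hmono ht h0
    have key : ∀ i : Fin (k + 1), ∃ c ∈ Set.Ioo (t i.castSucc) (t i.succ),
        derivWithin f (Set.Icc a b) c = 0 := by
      intro i
      have hlt : t i.castSucc < t i.succ := hmono Fin.castSucc_lt_succ
      obtain ⟨c, hc, hc0⟩ := exists_deriv_eq_zero hlt
        (hf.continuousOn.mono (Set.Icc_subset_Icc (ht _).1 (ht _).2)) ((h0 _).trans (h0 _).symm)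
      refine ⟨c, hc, ?_⟩
      -- The Rolle point is interior to `[a, b]`, so the derivative within the interval is the
      -- ordinary one.
      rw [derivWithin_of_mem_nhds, hc0]
      exact Icc_mem_nhds ((ht _).1.trans_lt hc.1) (hc.2.trans_le (ht _).2)
    choose c hc hc0 using key
    have hcm : StrictMono c := Fin.strictMono_iff_lt_succ.2 fun i =>
      (hc i.castSucc).2.trans (hc i.succ).1
    obtain ⟨ξ, hξ, h⟩ := ih (derivWithin f (Set.Icc a b)) (hf.derivWithin hu (by norm_cast)) c hcm
      (fun i => ⟨(ht _).1.trans (hc i).1.le, (hc i).2.le.trans (ht _).2⟩) hc0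
    exact ⟨ξ, hξ, by rw [iteratedDerivWithin_succ', h]⟩

theorem iteratedDerivWithin_polynomial_eval {a b : ℝ} (hab : a < b) (k : ℕ) (P : ℝ[X]) {ξ : ℝ}
    (hξ : ξ ∈ Set.Icc a b) :
    iteratedDerivWithin k (fun t => P.eval t) (Set.Icc a b) ξ = (derivative^[k] P).eval ξ := by
  have hc : ContDiff ℝ k (fun t => P.eval t) := by
    simpa using P.contDiff_aeval (𝕜 := ℝ) k
  rw [iteratedDerivWithin_eq_iteratedDeriv (uniqueDiffOn_Icc hab) hc.contDiffAt hξ,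
    iteratedDeriv_eq_iterate]
  have : ∀ (k : ℕ) (P : ℝ[X]),
      deriv^[k] (fun t => P.eval t) = fun t => (derivative^[k] P).eval t := by
    intro k
    induction k with
    | zero => intro P; rfl
    | succ k ih =>
      intro P
      have h1 : deriv (fun t => P.eval t) = fun t => (derivative P).eval t := by
        ext t; exact Polynomial.deriv P
      rw [Function.iterate_succ_apply, Function.iterate_succ_apply, h1, ih]
  rw [this]

theorem eval_iterate_derivative_of_natDegree_le {k : ℕ} {P : ℝ[X]} (hP : P.natDegree ≤ k)
    (ξ : ℝ) : (derivative^[k] P).eval ξ = k.factorial * P.coeff k := by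
  have h1 : (derivative^[k] P).natDegree ≤ 0 := by
    have := natDegree_iterate_derivative P k
    omega
  rw [eq_C_of_natDegree_le_zero h1, eval_C, coeff_iterate_derivative]
  simp [Nat.descFactorial_self]

/-- If `f` agrees with a polynomial of degree at most `k` at `k + 1` points, the `k`-th derivative
of `f` equals that of the polynomial somewhere. -/
theorem exists_iteratedDerivWithin_eq_coeff {a b : ℝ} (hab : a < b) {k : ℕ} {f : ℝ → ℝ}
    (hf : ContDiffOn ℝ k f (Set.Icc a b)) {P : ℝ[X]} (hP : P.natDegree ≤ k) (s : Finset ℝ)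
    (hs : s.card = k + 1) (hsI : ∀ t ∈ s, t ∈ Set.Icc a b) (h : ∀ t ∈ s, f t = P.eval t) :
    ∃ ξ ∈ Set.Icc a b, iteratedDerivWithin k f (Set.Icc a b) ξ = k.factorial * P.coeff k := by
  have hc : ContDiff ℝ k (fun t => P.eval t) := by
    simpa using P.contDiff_aeval (𝕜 := ℝ) k
  obtain ⟨ξ, hξ, h0⟩ := exists_iteratedDerivWithin_eq_zero hab k (f - fun t => P.eval t)
    (hf.sub hc.contDiffOn) (s.orderEmbOfFin hs) (s.orderEmbOfFin hs).strictMono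
    (fun i => hsI _ (s.orderEmbOfFin_mem hs i))
    (fun i => by simp [h _ (s.orderEmbOfFin_mem hs i)])
  refine ⟨ξ, hξ, ?_⟩
  rw [iteratedDerivWithin_sub hξ (uniqueDiffOn_Icc hab) (hf _ hξ) hc.contDiffAt.contDiffWithinAt,
    iteratedDerivWithin_polynomial_eval hab k P hξ,
    eval_iterate_derivative_of_natDegree_le hP] at h0
  linarith

/-! ### Sign of the primitive of the nodal polynomial with integer nodes -/

/-- The nodal polynomial of the nodes `0, 1, …, n - 1`. -/
noncomputable def unitNodal (n : ℕ) (s : ℝ) : ℝ := ∏ i ∈ Finset.range n, (s - i)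

theorem continuous_unitNodal (n : ℕ) : Continuous (unitNodal n) := by
  unfold unitNodal
  fun_prop

/-- Both sides are the product of `s - i` over `i = -1, …, n`. -/
theorem unitNodal_add_one (n : ℕ) (s : ℝ) :
    unitNodal (n + 1) (s + 1) * (s - n) = (s + 1) * unitNodal (n + 1) s := by
  unfold unitNodal
  rw [Finset.prod_range_succ', Finset.prod_range_succ]
  have : ∀ i ∈ Finset.range n, s + 1 - ((i + 1 : ℕ) : ℝ) = s - i := by
    intro i _
    push_cast
    ring
  rw [Finset.prod_congr rfl this]
  push_cast
  ring

theorem unitNodal_reflect (m : ℕ) (s : ℝ) :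
    unitNodal (2 * m + 1) (2 * m - s) = -unitNodal (2 * m + 1) s := by
  unfold unitNodal
  rw [← Finset.prod_range_reflect]
  have : ∀ i ∈ Finset.range (2 * m + 1),
      2 * (m : ℝ) - s - ((2 * m + 1 - 1 - i : ℕ) : ℝ) = -1 * (s - i) := by
    intro i hi
    have : i ≤ 2 * m := by have := Finset.mem_range.1 hi; omega
    rw [Nat.add_sub_cancel, Nat.cast_sub this]
    push_cast
    ring
  rw [Finset.prod_congr rfl this, Finset.prod_mul_distrib]
  simp [pow_succ]

theorem prod_range_even_nonneg {f : ℕ → ℝ} (hf : ∀ i, f i ≤ 0) (l : ℕ) :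
    0 ≤ ∏ i ∈ Finset.range (2 * l), f i := by
  induction l with
  | zero => simp
  | succ l ih =>
    rw [show 2 * (l + 1) = 2 * l + 1 + 1 by ring, Finset.prod_range_succ, Finset.prod_range_succ,
      mul_assoc]
    exact mul_nonneg ih (mul_nonneg_of_nonpos_of_nonpos (hf _) (hf _))

/-- The first `2k + 1` factors are nonnegative; the other `2(m - k)` are nonpositive and even in
number. -/
theorem unitNodal_nonneg {m k : ℕ} (hk : k ≤ m) {s : ℝ} (h1 : 2 * (k : ℝ) ≤ s)
    (h2 : s ≤ 2 * k + 1) : 0 ≤ unitNodal (2 * m + 1) s := by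
  unfold unitNodal
  rw [show 2 * m + 1 = (2 * k + 1) + 2 * (m - k) by omega, Finset.prod_range_add]
  refine mul_nonneg (Finset.prod_nonneg fun i hi => ?_) (prod_range_even_nonneg (fun i => ?_) _)
  · have : i ≤ 2 * k := by have := Finset.mem_range.1 hi; omega
    have : (i : ℝ) ≤ 2 * k := by exact_mod_cast this
    linarith
  · push_cast
    have : (0 : ℝ) ≤ i := i.cast_nonneg
    linarith

/-- Left of the midpoint `m`, a negative arch is dominated by the positive arch before it: by
`unitNodal_add_one`, the sum times `2m - s` is `unitNodal (2 * m + 1) s * (2m - 2s - 1)`. -/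
theorem unitNodal_add_shift_nonneg {m k : ℕ} {s : ℝ} (h1 : 2 * (k : ℝ) ≤ s)
    (h2 : s ≤ 2 * k + 1) (hm : s + 1 ≤ m) :
    0 ≤ unitNodal (2 * m + 1) s + unitNodal (2 * m + 1) (s + 1) := by
  have hk0 : (0 : ℝ) ≤ k := k.cast_nonneg
  have hk : k ≤ m := by
    have : (k : ℝ) ≤ m := by linarith
    exact_mod_cast this
  have h := unitNodal_nonneg hk h1 h2
  have hs := unitNodal_add_one (2 * m) s
  push_cast at hs
  have hpos : 0 < 2 * (m : ℝ) - s := by linarith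
  have : 0 ≤ (unitNodal (2 * m + 1) s + unitNodal (2 * m + 1) (s + 1)) * (2 * m - s) := by
    have : (unitNodal (2 * m + 1) s + unitNodal (2 * m + 1) (s + 1)) * (2 * m - s)
        = unitNodal (2 * m + 1) s * (2 * m - 2 * s - 1) := by linarith
    rw [this]
    exact mul_nonneg h (by linarith)
  exact nonneg_of_mul_nonneg_left this hpos

theorem intervalIntegrable_unitNodal (n : ℕ) (c d : ℝ) :
    IntervalIntegrable (unitNodal n) volume c d :=
  (continuous_unitNodal n).intervalIntegrable c d

/-- Induction over pairs of unit intervals: within `[2k, 2k + 2]` the positive arch comes first and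
outweighs the negative one. -/
theorem integral_unitNodal_nonneg_half (m k : ℕ) :
    ∀ x : ℝ, 2 * (k : ℝ) ≤ x → x ≤ 2 * k + 2 → x ≤ m →
      0 ≤ ∫ t in (0 : ℝ)..x, unitNodal (2 * m + 1) t := by
  have hi := intervalIntegrable_unitNodal (2 * m + 1)
  have step : ∀ k : ℕ, (2 * (k : ℝ) ≤ m → 0 ≤ ∫ t in (0 : ℝ)..(2 * k), unitNodal (2 * m + 1) t) →
      ∀ x : ℝ, 2 * (k : ℝ) ≤ x → x ≤ 2 * k + 2 → x ≤ m →
      0 ≤ ∫ t in (0 : ℝ)..x, unitNodal (2 * m + 1) t := by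
    intro k h0 x h1 h2 h3
    have hk0 : (0 : ℝ) ≤ k := k.cast_nonneg
    have hk : k ≤ m := by
      have : (k : ℝ) ≤ m := by linarith
      exact_mod_cast this
    have h0 := h0 (h1.trans h3)
    rw [← intervalIntegral.integral_add_adjacent_intervals (hi 0 (2 * k)) (hi (2 * k) x)]
    refine add_nonneg h0 ?_
    rcases le_total x (2 * k + 1) with hx | hx
    · exact intervalIntegral.integral_nonneg h1 fun t ht =>
        unitNodal_nonneg hk ht.1 (ht.2.trans hx)
    -- The piece `[2k + 1, x]` is paired with its translate `[2k, x - 1]`; what remains, `[x - 1, 2k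
    -- + 1]`, lies in the positive arch.
    · rw [← intervalIntegral.integral_add_adjacent_intervals (hi (2 * k) (2 * k + 1)) (hi _ x),
        ← intervalIntegral.integral_add_adjacent_intervals (hi (2 * k) (x - 1)) (hi _ (2 * k + 1))]
      have hshift : ∫ t in (2 * (k : ℝ) + 1)..x, unitNodal (2 * m + 1) t
          = ∫ t in (2 * (k : ℝ))..(x - 1), unitNodal (2 * m + 1) (t + 1) := by
        rw [intervalIntegral.integral_comp_add_right (unitNodal (2 * m + 1)), sub_add_cancel]
      have hsum : 0 ≤ (∫ t in (2 * (k : ℝ))..(x - 1), unitNodal (2 * m + 1) t)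
          + ∫ t in (2 * (k : ℝ))..(x - 1), unitNodal (2 * m + 1) (t + 1) := by
        rw [← intervalIntegral.integral_add (hi _ _)
          (Continuous.intervalIntegrable (by
            exact (continuous_unitNodal _).comp (continuous_add_const 1)) _ _)]
        refine intervalIntegral.integral_nonneg (by linarith) fun t ht => ?_
        exact unitNodal_add_shift_nonneg ht.1 (by linarith [ht.2]) (by linarith [ht.2])
      have hmid : 0 ≤ ∫ t in (x - 1)..(2 * (k : ℝ) + 1), unitNodal (2 * m + 1) t :=
        intervalIntegral.integral_nonneg (by linarith) fun t ht =>
          unitNodal_nonneg hk (by linarith [ht.1]) ht.2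
      linarith
  induction k with
  | zero => exact step 0 (by simp)
  | succ k ih =>
    refine step (k + 1) fun h => ?_
    push_cast at h ⊢
    exact ih _ (by linarith) (by linarith) h

theorem integral_unitNodal_reflect (m : ℕ) (x : ℝ) :
    ∫ t in (2 * m - x)..(2 * (m : ℝ)), unitNodal (2 * m + 1) t
      = -∫ t in (0 : ℝ)..x, unitNodal (2 * m + 1) t := by
  have h := intervalIntegral.integral_comp_sub_left (a := 0) (b := x) (unitNodal (2 * m + 1))
    (2 * (m : ℝ))
  simp only [unitNodal_reflect, sub_zero, intervalIntegral.integral_neg] at h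
  exact h.symm

theorem integral_unitNodal_eq_zero (m : ℕ) :
    ∫ t in (0 : ℝ)..(2 * m), unitNodal (2 * m + 1) t = 0 := by
  have := integral_unitNodal_reflect m (2 * m)
  rw [sub_self] at this
  linarith

/-- Oddness about `m` makes the primitive take equal values at `x` and `2m - x`, so the left half
suffices. -/
theorem integral_unitNodal_nonneg {m : ℕ} {x : ℝ} (h0 : 0 ≤ x) (hx : x ≤ 2 * m) :
    0 ≤ ∫ t in (0 : ℝ)..x, unitNodal (2 * m + 1) t := by
  have half : ∀ x : ℝ, 0 ≤ x → x ≤ m → 0 ≤ ∫ t in (0 : ℝ)..x, unitNodal (2 * m + 1) t := by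
    intro x h0 hx
    have h1 := Nat.floor_le (a := x / 2) (by linarith)
    have h2 := (Nat.lt_floor_add_one (x / 2)).le
    exact integral_unitNodal_nonneg_half m ⌊x / 2⌋₊ x (by linarith) (by linarith) hx
  rcases le_total x m with h | h
  · exact half x h0 h
  · have hi := intervalIntegrable_unitNodal (2 * m + 1)
    have h1 := half (2 * m - x) (by linarith) (by linarith)
    have h2 := integral_unitNodal_reflect m (2 * m - x)
    rw [sub_sub_cancel] at h2
    have h3 := intervalIntegral.integral_add_adjacent_intervals (hi 0 x) (hi x (2 * m))
    rw [integral_unitNodal_eq_zero] at h3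
    linarith

/-- Source of the strict sign of `I(w_N)` for odd `n`. -/
theorem integral_unitNodal_zero_one_pos (m : ℕ) :
    0 < ∫ t in (0 : ℝ)..1, unitNodal (2 * m + 1) t := by
  have hnn : ∀ t ∈ Set.Icc (0 : ℝ) 1, 0 ≤ unitNodal (2 * m + 1) t := fun t ht =>
    unitNodal_nonneg (k := 0) (Nat.zero_le m) (by simpa using ht.1) (by simpa using ht.2)
  refine intervalIntegral.integral_pos one_pos (continuous_unitNodal _).continuousOn
    (fun t ht => hnn t ⟨ht.1.le, ht.2⟩) ⟨1 / 2, by norm_num, ?_⟩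
  refine lt_of_le_of_ne (hnn _ (by norm_num)) (Ne.symm (Finset.prod_ne_zero_iff.2 fun i _ h => ?_))
  have h2 : ((2 * i : ℕ) : ℝ) = (1 : ℕ) := by push_cast; linarith
  have h3 : 2 * i = 1 := by exact_mod_cast h2
  omega

/-! ### Newton's polynomials and their primitives on the panel -/

theorem newtonPoly_eval (x : ℕ → ℝ) (k : ℕ) (t : ℝ) :
    (newtonPoly x k).eval t = ∏ i ∈ Finset.range k, (t - x i) := by
  induction k with
  | zero => simp [newtonPoly]
  | succ k ih => simp [newtonPoly, ih, Finset.prod_range_succ]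

theorem newtonPoly_monic (x : ℕ → ℝ) (k : ℕ) : (newtonPoly x k).Monic := by
  induction k with
  | zero => exact monic_one
  | succ k ih => exact ih.mul (monic_X_sub_C _)

theorem newtonPoly_natDegree (x : ℕ → ℝ) (k : ℕ) : (newtonPoly x k).natDegree = k := by
  induction k with
  | zero => simp [newtonPoly]
  | succ k ih =>
    rw [newtonPoly, (newtonPoly_monic x k).natDegree_mul (monic_X_sub_C _), ih, natDegree_X_sub_C]

theorem newtonPoly_coeff_self (x : ℕ → ℝ) (k : ℕ) : (newtonPoly x k).coeff k = 1 := by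
  have := newtonPoly_monic x k
  rwa [Monic, leadingCoeff, newtonPoly_natDegree] at this

theorem newtonPoly_eval_node (x : ℕ → ℝ) {k i : ℕ} (hi : i < k) :
    (newtonPoly x k).eval (x i) = 0 := by
  rw [newtonPoly_eval]
  exact Finset.prod_eq_zero (Finset.mem_range.2 hi) (sub_self _)

theorem continuous_newtonPoly_eval (x : ℕ → ℝ) (k : ℕ) :
    Continuous fun t => (newtonPoly x k).eval t := (newtonPoly x k).continuous

theorem newtonPoly_node_eval (x₁ : ℝ) {h : ℝ} (hh : 0 < h) (k : ℕ) (t : ℝ) :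
    (newtonPoly (node x₁ h) k).eval t = h ^ k * unitNodal k (t / h - x₁ / h) := by
  rw [newtonPoly_eval, unitNodal, ← Finset.card_range k, ← Finset.prod_const, Finset.card_range,
    ← Finset.prod_mul_distrib]
  refine Finset.prod_congr rfl fun i _ => ?_
  rw [node]
  field_simp
  ring

theorem integral_newtonPoly_node (x₁ : ℝ) {h : ℝ} (hh : 0 < h) (k : ℕ) (x : ℝ) :
    ∫ t in (node x₁ h 0)..x, (newtonPoly (node x₁ h) k).eval t
      = h ^ (k + 1) * ∫ s in (0 : ℝ)..((x - x₁) / h), unitNodal k s := by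
  simp only [newtonPoly_node_eval x₁ hh, intervalIntegral.integral_const_mul]
  rw [intervalIntegral.integral_comp_div_sub (unitNodal k) hh.ne', node, Nat.cast_zero, zero_mul,
    add_zero, sub_self, sub_div, smul_eq_mul]
  ring

theorem integral_newtonPoly_nonneg (x₁ : ℝ) {h : ℝ} (hh : 0 < h) (m : ℕ) {x : ℝ}
    (hx : x ∈ Set.Icc (node x₁ h 0) (node x₁ h (2 * m))) :
    0 ≤ ∫ t in (node x₁ h 0)..x, (newtonPoly (node x₁ h) (2 * m + 1)).eval t := by
  rw [integral_newtonPoly_node x₁ hh]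
  obtain ⟨h1, h2⟩ := hx
  simp only [node] at h1 h2
  push_cast at h1 h2
  refine mul_nonneg (by positivity) (integral_unitNodal_nonneg (div_nonneg (by linarith) hh.le) ?_)
  rw [div_le_iff₀ hh]
  linarith

theorem integral_newtonPoly_eq_zero (x₁ : ℝ) {h : ℝ} (hh : 0 < h) (m : ℕ) :
    ∫ t in (node x₁ h 0)..(node x₁ h (2 * m)), (newtonPoly (node x₁ h) (2 * m + 1)).eval t = 0 := by
  rw [integral_newtonPoly_node x₁ hh]
  have : (node x₁ h (2 * m) - x₁) / h = 2 * m := by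
    simp only [node]
    field_simp
    push_cast
    ring
  rw [this, integral_unitNodal_eq_zero, mul_zero]

theorem integral_newtonPoly_first_step_pos (x₁ : ℝ) {h : ℝ} (hh : 0 < h) (m : ℕ) :
    0 < ∫ t in (node x₁ h 0)..(node x₁ h 1), (newtonPoly (node x₁ h) (2 * m + 1)).eval t := by
  rw [integral_newtonPoly_node x₁ hh]
  have : (node x₁ h 1 - x₁) / h = 1 := by
    simp only [node]
    field_simp
    push_cast
    ring
  rw [this]
  exact mul_pos (by positivity) (integral_unitNodal_zero_one_pos m)

theorem node_strictMono (x₁ : ℝ) {h : ℝ} (hh : 0 < h) : StrictMono (node x₁ h) := by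
  intro i j hij
  have : (i : ℝ) < j := by exact_mod_cast hij
  simp only [node]
  nlinarith

/-! ### Integrals against a monotone factor -/

/-- Abel summation with nonnegative partial sums against an increasing sequence. -/
theorem sum_mul_sub_nonpos (q W : ℕ → ℝ) (N : ℕ) (hq : Monotone q) (hW : ∀ i ≤ N, 0 ≤ W i)
    (h0 : W 0 = 0) :
    ∑ i ∈ Finset.range N, q i * (W (i + 1) - W i) ≤ q N * W N := by
  induction N with
  | zero => simp [h0]
  | succ N ih =>
    rw [Finset.sum_range_succ]
    have h1 := ih fun i hi => hW i (by omega)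
    have h2 := mul_le_mul_of_nonneg_right (hq (Nat.le_succ N)) (hW (N + 1) le_rfl)
    simp only [Nat.succ_eq_add_one] at h2
    nlinarith

/-- If the primitive of `w` is nonnegative and vanishes at both ends, then `∫ w q ≤ 0` for every
monotone `q`. -/
theorem integral_mul_monotone_nonpos {w q : ℝ → ℝ} (hw : Continuous w) (hq : Monotone q)
    {a b : ℝ} (hab : a ≤ b) (hW : ∀ x ∈ Set.Icc a b, 0 ≤ ∫ t in a..x, w t)
    (hWb : ∫ t in a..b, w t = 0) : ∫ t in a..b, w t * q t ≤ 0 := by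
  obtain ⟨M, hM⟩ := isCompact_Icc.exists_bound_of_continuousOn (s := Set.Icc a b) hw.continuousOn
  have hiq : ∀ c d, IntervalIntegrable q volume c d := fun c d => hq.intervalIntegrable
  have hiw : ∀ c d, IntervalIntegrable w volume c d := fun c d => hw.intervalIntegrable c d
  have hiwq : ∀ c d, IntervalIntegrable (fun t => w t * q t) volume c d :=
    fun c d => (hiq c d).continuousOn_mul hw.continuousOn
  -- As `q` is merely monotone, integration by parts is replaced by Abel summation on `N` equal
  -- pieces, with an error that tends to `0`.
  have key : ∀ N : ℕ, 0 < N →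
      ∫ t in a..b, w t * q t ≤ M * (b - a) * (q b - q a) / N := by
    intro N hN
    have hN' : (0 : ℝ) < N := by exact_mod_cast hN
    set δ := (b - a) / N with hδ
    have hδ0 : 0 ≤ δ := div_nonneg (by linarith) hN'.le
    set p : ℕ → ℝ := fun i => a + i * δ with hp
    have hp0 : p 0 = a := by simp [hp]
    have hpN : p N = b := by simp only [hp, hδ]; field_simp; ring
    have hpm : Monotone p := by
      intro i j hij
      have : (i : ℝ) ≤ j := by exact_mod_cast hij
      simp only [hp]
      nlinarith
    have hsplit : ∫ t in a..b, w t * q t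
        = ∑ i ∈ Finset.range N, ∫ t in (p i)..(p (i + 1)), w t * q t := by
      rw [intervalIntegral.sum_integral_adjacent_intervals fun i _ => hiwq _ _, hp0, hpN]
    have hstep : ∀ i ∈ Finset.range N, ∫ t in (p i)..(p (i + 1)), w t * q t
        ≤ q (p i) * ((∫ t in a..(p (i + 1)), w t) - ∫ t in a..(p i), w t)
          + M * δ * (q (p (i + 1)) - q (p i)) := by
      intro i hi
      have hiN : i + 1 ≤ N := Finset.mem_range.1 hi
      have hle : p i ≤ p (i + 1) := hpm (Nat.le_succ i)
      have ha : a ≤ p i := hp0 ▸ hpm (Nat.zero_le i)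
      have hb : p (i + 1) ≤ b := hpN ▸ hpm hiN
      have hd : p (i + 1) - p i = δ := by simp only [hp]; push_cast; ring
      rw [intervalIntegral.integral_interval_sub_left (hiw _ _) (hiw _ _),
        ← intervalIntegral.integral_const_mul]
      -- Freezing `q` at the left endpoint costs at most `M δ` times its increment; these increments
      -- telescope over the pieces.
      have hbd : ∫ t in (p i)..(p (i + 1)), (w t * q t - q (p i) * w t)
          ≤ ∫ t in (p i)..(p (i + 1)), M * (q (p (i + 1)) - q (p i)) := by
        apply intervalIntegral.integral_mono_on hle
          ((hiwq _ _).sub ((hiw _ _).const_mul _)) (by simp)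
        intro t ht
        have h1 := hM t ⟨ha.trans ht.1, ht.2.trans hb⟩
        rw [Real.norm_eq_abs] at h1
        have h2 := hq ht.1
        have h3 := hq ht.2
        have h4 := le_abs_self (w t)
        have h5 : w t * (q t - q (p i)) ≤ M * (q t - q (p i)) :=
          mul_le_mul_of_nonneg_right (h4.trans h1) (by linarith)
        have h6 : M * (q t - q (p i)) ≤ M * (q (p (i + 1)) - q (p i)) :=
          mul_le_mul_of_nonneg_left (by linarith) ((abs_nonneg _).trans h1)
        nlinarith
      rw [intervalIntegral.integral_sub (hiwq _ _) ((hiw _ _).const_mul _),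
        intervalIntegral.integral_const, smul_eq_mul, hd] at hbd
      linarith
    have habel := sum_mul_sub_nonpos (fun i => q (p i)) (fun i => ∫ t in a..(p i), w t) N
      (hq.comp hpm)
      (fun i hi => hW _ ⟨hp0 ▸ hpm (Nat.zero_le i), hpN ▸ hpm hi⟩) (by simp [hp0])
    simp only [hpN, hWb, mul_zero] at habel
    rw [hsplit]
    refine (Finset.sum_le_sum hstep).trans ?_
    rw [Finset.sum_add_distrib, ← Finset.mul_sum, Finset.sum_range_sub (fun i => q (p i)), hpN, hp0]
    have : M * δ * (q b - q a) = M * (b - a) * (q b - q a) / N := by rw [hδ]; ring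
    linarith
  have hlim := tendsto_const_div_atTop_nhds_zero_nat (M * (b - a) * (q b - q a))
  refine ge_of_tendsto hlim ?_
  filter_upwards [Filter.eventually_gt_atTop 0] with N hN using key N hN

/-! ### Quotients by the nodal polynomial -/

theorem newtonPoly_eval_ne_zero {x : ℕ → ℝ} {k : ℕ} {y : ℝ} (hy : ∀ i < k, y ≠ x i) :
    (newtonPoly x k).eval y ≠ 0 := by
  rw [newtonPoly_eval]
  exact Finset.prod_ne_zero_iff.2 fun i hi => sub_ne_zero.2 (hy i (Finset.mem_range.1 hi))

/-- The quotient of `r` by the nodal polynomial is a `k`-th derivative of `r`, if `r` vanishes at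
the `k` nodes. -/
theorem exists_div_newtonPoly_eq {a b : ℝ} (hab : a < b) {x : ℕ → ℝ} (hx : StrictMono x) {k : ℕ}
    (hxI : ∀ i < k, x i ∈ Set.Icc a b) {r : ℝ → ℝ} (hr : ContDiffOn ℝ k r (Set.Icc a b))
    (hr0 : ∀ i < k, r (x i) = 0) {y : ℝ} (hyI : y ∈ Set.Icc a b) (hy : ∀ i < k, y ≠ x i) :
    ∃ ξ ∈ Set.Icc a b, iteratedDerivWithin k r (Set.Icc a b) ξ
      = k.factorial * (r y / (newtonPoly x k).eval y) := by
  have hmem : ∀ t ∈ insert y ((Finset.range k).image x), t = y ∨ ∃ i < k, t = x i := by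
    intro t ht
    simp only [Finset.mem_insert, Finset.mem_image, Finset.mem_range] at ht
    rcases ht with h | ⟨i, hi, h⟩
    · exact Or.inl h
    · exact Or.inr ⟨i, hi, h.symm⟩
  have hw := newtonPoly_eval_ne_zero hy
  have hcard : (insert y ((Finset.range k).image x)).card = k + 1 := by
    rw [Finset.card_insert_of_notMem, Finset.card_image_of_injective _ hx.injective,
      Finset.card_range]
    simp only [Finset.mem_image, Finset.mem_range, not_exists, not_and]
    exact fun i hi h => hy i hi h.symm
  have hsI : ∀ t ∈ insert y ((Finset.range k).image x), t ∈ Set.Icc a b := by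
    intro t ht
    rcases hmem t ht with rfl | ⟨i, hi, rfl⟩
    exacts [hyI, hxI i hi]
  have hev : ∀ t ∈ insert y ((Finset.range k).image x),
      r t = (C (r y / (newtonPoly x k).eval y) * newtonPoly x k).eval t := by
    intro t ht
    rcases hmem t ht with rfl | ⟨i, hi, rfl⟩
    · rw [eval_mul, eval_C, div_mul_cancel₀ _ hw]
    · rw [eval_mul, newtonPoly_eval_node x hi, mul_zero, hr0 i hi]
  obtain ⟨ξ, hξ, h⟩ := exists_iteratedDerivWithin_eq_coeff hab hr
    (P := C (r y / (newtonPoly x k).eval y) * newtonPoly x k)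
    ((natDegree_C_mul_le _ _).trans (newtonPoly_natDegree x k).le)
    (insert y ((Finset.range k).image x)) hcard hsI hev
  refine ⟨ξ, hξ, h.trans ?_⟩
  rw [coeff_C_mul, newtonPoly_coeff_self, mul_one]

/-- The quotient of `r` by the nodal polynomial of `k` zeros of `r` is increasing off the nodes if
the derivative of order `k + 1` of `r` is nonnegative. -/
theorem div_newtonPoly_le {a b : ℝ} (hab : a < b) {x : ℕ → ℝ} (hx : StrictMono x) {k : ℕ}
    (hxI : ∀ i < k, x i ∈ Set.Icc a b) {r : ℝ → ℝ}
    (hr : ContDiffOn ℝ (k + 1 : ℕ) r (Set.Icc a b)) (hr0 : ∀ i < k, r (x i) = 0)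
    (hD : ∀ t ∈ Set.Icc a b, 0 ≤ iteratedDerivWithin (k + 1) r (Set.Icc a b) t)
    {y z : ℝ} (hyI : y ∈ Set.Icc a b) (hy : ∀ i < k, y ≠ x i) (hzI : z ∈ Set.Icc a b)
    (hz : ∀ i < k, z ≠ x i) (hyz : y < z) :
    r y / (newtonPoly x k).eval y ≤ r z / (newtonPoly x k).eval z := by
  set α := r y / (newtonPoly x k).eval y with hα
  set α' := r z / (newtonPoly x k).eval z with hα'
  -- `β` is the slope of the quotient between `y` and `z`. The polynomial `w_k · (α + β (X - y))`
  -- agrees with `r` at the `k` nodes, `y` and `z`, and its coefficient in degree `k + 1` is `β`;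
  -- Rolle then gives `β` the sign of the derivative.
  set β := (α' - α) / (z - y) with hβ
  have hwy := newtonPoly_eval_ne_zero hy
  have hwz := newtonPoly_eval_ne_zero hz
  have hzy : z - y ≠ 0 := by linarith
  have hmem : ∀ t ∈ insert y (insert z ((Finset.range k).image x)),
      t = y ∨ t = z ∨ ∃ i < k, t = x i := by
    intro t ht
    simp only [Finset.mem_insert, Finset.mem_image, Finset.mem_range] at ht
    rcases ht with h | h | ⟨i, hi, h⟩
    · exact Or.inl h
    · exact Or.inr (Or.inl h)
    · exact Or.inr (Or.inr ⟨i, hi, h.symm⟩)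
  have hlin : (C α + C β * (X - C y)).natDegree ≤ 1 := by
    compute_degree
  have hcard : (insert y (insert z ((Finset.range k).image x))).card = k + 1 + 1 := by
    rw [Finset.card_insert_of_notMem, Finset.card_insert_of_notMem,
      Finset.card_image_of_injective _ hx.injective, Finset.card_range]
    · simp only [Finset.mem_image, Finset.mem_range, not_exists, not_and]
      exact fun i hi h => hz i hi h.symm
    · simp only [Finset.mem_insert, Finset.mem_image, Finset.mem_range, not_or, not_exists, not_and]
      exact ⟨hyz.ne, fun i hi h => hy i hi h.symm⟩
  have hsI : ∀ t ∈ insert y (insert z ((Finset.range k).image x)), t ∈ Set.Icc a b := by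
    intro t ht
    rcases hmem t ht with rfl | rfl | ⟨i, hi, rfl⟩
    exacts [hyI, hzI, hxI i hi]
  have hev : ∀ t ∈ insert y (insert z ((Finset.range k).image x)),
      r t = (newtonPoly x k * (C α + C β * (X - C y))).eval t := by
    intro t ht
    rcases hmem t ht with h | h | ⟨i, hi, rfl⟩
    · simp only [h, eval_mul, eval_add, eval_sub, eval_C, eval_X, sub_self, mul_zero, add_zero]
      rw [hα, mul_div_cancel₀ _ hwy]
    · simp only [h, eval_mul, eval_add, eval_sub, eval_C, eval_X]
      rw [hβ, div_mul_cancel₀ _ hzy, add_sub_cancel, hα', mul_div_cancel₀ _ hwz]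
    · rw [eval_mul, newtonPoly_eval_node x hi, zero_mul, hr0 i hi]
  obtain ⟨ξ, hξ, h⟩ := exists_iteratedDerivWithin_eq_coeff hab hr
    (P := newtonPoly x k * (C α + C β * (X - C y)))
    (natDegree_mul_le.trans (add_le_add (newtonPoly_natDegree x k).le hlin))
    (insert y (insert z ((Finset.range k).image x))) hcard hsI hev
  rw [coeff_mul_add_eq_of_natDegree_le (newtonPoly_natDegree x k).le hlin, newtonPoly_coeff_self,
    one_mul] at h
  have h1 : (C α + C β * (X - C y)).coeff 1 = β := by
    simp [coeff_X]
  rw [h1] at h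
  have h2 : 0 ≤ ((k + 1).factorial : ℝ) * β := h ▸ hD ξ hξ
  have h3 : 0 ≤ β := nonneg_of_mul_nonneg_right h2 (by positivity)
  have h4 : α' - α = β * (z - y) := by rw [hβ, div_mul_cancel₀ _ hzy]
  have : 0 ≤ β * (z - y) := mul_nonneg h3 (by linarith)
  linarith

/-! ### Sign of the integral of a function vanishing at the nodes -/

theorem integral_nonpos_of_odd_nodes {a b : ℝ} (hab : a < b) (x₁ : ℝ) {h : ℝ} (hh : 0 < h) (m : ℕ)
    (hxI : ∀ i < 2 * m + 1, node x₁ h i ∈ Set.Icc a b) {r : ℝ → ℝ}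
    (hr : ContDiffOn ℝ (2 * m + 2 : ℕ) r (Set.Icc a b))
    (hr0 : ∀ i < 2 * m + 1, r (node x₁ h i) = 0)
    (hD : ∀ t ∈ Set.Icc a b, 0 ≤ iteratedDerivWithin (2 * m + 2) r (Set.Icc a b) t) :
    ∫ t in (node x₁ h 0)..(node x₁ h (2 * m)), r t ≤ 0 := by
  have hx := node_strictMono x₁ hh
  set w := newtonPoly (node x₁ h) (2 * m + 1) with hw
  have hr' : ContDiffOn ℝ (2 * m + 1 : ℕ) r (Set.Icc a b) := hr.of_le (by norm_cast; omega)
  set G := Set.Icc a b ∩ {t | ∀ i < 2 * m + 1, t ≠ node x₁ h i} with hG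
  have hmono : MonotoneOn (fun t => r t / w.eval t) G := by
    intro y hy z hz hyz
    rcases hyz.eq_or_lt with rfl | hlt
    · exact le_rfl
    · exact div_newtonPoly_le hab hx hxI hr hr0 hD hy.1 hy.2 hz.1 hz.2 hlt
  obtain ⟨M, hM⟩ := isCompact_Icc.exists_bound_of_continuousOn
    (hr'.continuousOn_iteratedDerivWithin le_rfl (uniqueDiffOn_Icc hab))
  have hbd : ∀ y ∈ G, |r y / w.eval y| ≤ M := by
    intro y hy
    obtain ⟨ξ, hξ, h1⟩ := exists_div_newtonPoly_eq hab hx hxI hr' hr0 hy.1 hy.2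
    have h2 := hM ξ hξ
    rw [h1, Real.norm_eq_abs, abs_mul, Nat.abs_cast] at h2
    have h3 : (1 : ℝ) ≤ (2 * m + 1).factorial := by exact_mod_cast Nat.factorial_pos _
    exact (le_mul_of_one_le_left (abs_nonneg _) h3).trans h2
  -- The quotient makes sense only off the nodes. Being bounded there, it extends to a monotone
  -- function on the line; its values at the nodes are immaterial, since `w` and `r` vanish there.
  obtain ⟨q, hq, hqG⟩ := hmono.exists_monotone_extension
    ⟨-M, by rintro _ ⟨y, hy, rfl⟩; exact (abs_le.1 (hbd y hy)).1⟩
    ⟨M, by rintro _ ⟨y, hy, rfl⟩; exact (abs_le.1 (hbd y hy)).2⟩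
  have hle : node x₁ h 0 ≤ node x₁ h (2 * m) := hx.monotone (Nat.zero_le _)
  have heq : ∫ t in (node x₁ h 0)..(node x₁ h (2 * m)), r t
      = ∫ t in (node x₁ h 0)..(node x₁ h (2 * m)), w.eval t * q t := by
    refine intervalIntegral.integral_congr fun t ht => ?_
    rw [Set.uIcc_of_le hle] at ht
    have htI : t ∈ Set.Icc a b := ⟨(hxI 0 (by omega)).1.trans ht.1,
      ht.2.trans (hxI (2 * m) (by omega)).2⟩
    by_cases hn : ∀ i < 2 * m + 1, t ≠ node x₁ h i
    · simp only [← hqG ⟨htI, hn⟩]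
      rw [mul_div_cancel₀ _ (newtonPoly_eval_ne_zero hn)]
    · push Not at hn
      obtain ⟨i, hi, rfl⟩ := hn
      simp only [hr0 i hi, hw, newtonPoly_eval_node _ hi, zero_mul]
  rw [heq]
  exact integral_mul_monotone_nonpos w.continuous hq hle
    (fun y hy => integral_newtonPoly_nonneg x₁ hh m hy) (integral_newtonPoly_eq_zero x₁ hh m)

theorem newtonPoly_eval_nonpos_last {x : ℕ → ℝ} (hx : StrictMono x) (k : ℕ) {t : ℝ}
    (ht : t ∈ Set.Icc (x k) (x (k + 1))) : (newtonPoly x (k + 2)).eval t ≤ 0 := by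
  rw [newtonPoly_eval, Finset.prod_range_succ]
  refine mul_nonpos_of_nonneg_of_nonpos (Finset.prod_nonneg fun i hi => ?_)
    (by linarith [ht.2])
  have : x i ≤ x k := hx.monotone (by have := Finset.mem_range.1 hi; omega)
  linarith [ht.1]

/-- The first `2m + 1` nodes fall under the odd case with the same derivative order `2m + 2`. On the
last step `r` is a nonnegative multiple of `w_{2m+2}` at each point off the nodes, and `w_{2m+2} ≤
0` there. -/
theorem integral_nonpos_of_even_nodes {a b : ℝ} (hab : a < b) (x₁ : ℝ) {h : ℝ} (hh : 0 < h)
    (m : ℕ) (hxI : ∀ i < 2 * m + 2, node x₁ h i ∈ Set.Icc a b) {r : ℝ → ℝ}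
    (hr : ContDiffOn ℝ (2 * m + 2 : ℕ) r (Set.Icc a b))
    (hr0 : ∀ i < 2 * m + 2, r (node x₁ h i) = 0)
    (hD : ∀ t ∈ Set.Icc a b, 0 ≤ iteratedDerivWithin (2 * m + 2) r (Set.Icc a b) t) :
    ∫ t in (node x₁ h 0)..(node x₁ h (2 * m + 1)), r t ≤ 0 := by
  have hx := node_strictMono x₁ hh
  have hle : node x₁ h (2 * m) ≤ node x₁ h (2 * m + 1) := hx.monotone (Nat.le_succ _)
  have hii : ∀ i < 2 * m + 2, ∀ j < 2 * m + 2,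
      IntervalIntegrable r volume (node x₁ h i) (node x₁ h j) := fun i hi j hj =>
    (hr.continuousOn.mono (Set.uIcc_subset_Icc (hxI i hi) (hxI j hj))).intervalIntegrable
  rw [← intervalIntegral.integral_add_adjacent_intervals (hii 0 (by omega) (2 * m) (by omega))
    (hii _ (by omega) _ (by omega))]
  refine add_nonpos (integral_nonpos_of_odd_nodes hab x₁ hh m (fun i hi => hxI i (by omega)) hr
    (fun i hi => hr0 i (by omega)) hD) ?_
  have hpt : ∀ t ∈ Set.Icc (node x₁ h (2 * m)) (node x₁ h (2 * m + 1)), r t ≤ 0 := by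
    intro t ht
    have htI : t ∈ Set.Icc a b := ⟨(hxI (2 * m) (by omega)).1.trans ht.1,
      ht.2.trans (hxI (2 * m + 1) (by omega)).2⟩
    by_cases hn : ∀ i < 2 * m + 2, t ≠ node x₁ h i
    · obtain ⟨ξ, hξ, h1⟩ := exists_div_newtonPoly_eq hab hx hxI hr hr0 htI hn
      have h2 : 0 ≤ r t / (newtonPoly (node x₁ h) (2 * m + 2)).eval t :=
        nonneg_of_mul_nonneg_right (h1 ▸ hD ξ hξ) (by positivity)
      have h3 := mul_nonpos_of_nonneg_of_nonpos h2 (newtonPoly_eval_nonpos_last hx (2 * m) ht)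
      rwa [div_mul_cancel₀ _ (newtonPoly_eval_ne_zero hn)] at h3
    · push Not at hn
      obtain ⟨i, hi, rfl⟩ := hn
      exact (hr0 i hi).le
  have := intervalIntegral.integral_mono_on hle (hii _ (by omega) _ (by omega))
    (intervalIntegrable_const (c := (0 : ℝ))) hpt
  simpa using this

/-! ### Strict negativity of the error constant -/

theorem integral_newtonPoly_even_neg (x₁ : ℝ) {h : ℝ} (hh : 0 < h) (m : ℕ) :
    ∫ t in (node x₁ h 0)..(node x₁ h (2 * m + 1)), (newtonPoly (node x₁ h) (2 * m + 2)).eval t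
      < 0 := by
  have hx := node_strictMono x₁ hh
  have hii := fun c d => (continuous_newtonPoly_eval (node x₁ h) (2 * m + 2)).intervalIntegrable
    (μ := volume) c d
  rw [← intervalIntegral.integral_add_adjacent_intervals (hii _ (node x₁ h (2 * m))) (hii _ _)]
  refine add_neg_of_nonpos_of_neg ?_ ?_
  -- Here `w_{2m+2}` is `w_{2m+1}` times the increasing factor `t - x_{2m+1}` (nodes counted from
  -- `0`); strictness comes from the last step alone.
  · have := integral_mul_monotone_nonpos
      (continuous_newtonPoly_eval (node x₁ h) (2 * m + 1))
      (q := fun t => t - node x₁ h (2 * m + 1)) (fun s t hst => by simpa using hst)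
      (hx.monotone (Nat.zero_le (2 * m))) (fun y hy => integral_newtonPoly_nonneg x₁ hh m hy)
      (integral_newtonPoly_eq_zero x₁ hh m)
    simpa [newtonPoly] using this
  · have hlt : node x₁ h (2 * m) < node x₁ h (2 * m + 1) := hx (Nat.lt_succ_self _)
    rw [← neg_pos, ← intervalIntegral.integral_neg]
    refine intervalIntegral.integral_pos hlt
      (continuous_newtonPoly_eval (node x₁ h) (2 * m + 2)).neg.continuousOn
      (fun t ht => neg_nonneg.2 (newtonPoly_eval_nonpos_last hx _ ⟨ht.1.le, ht.2⟩)) ?_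
    obtain ⟨c, hc1, hc2⟩ := exists_between hlt
    refine ⟨c, ⟨hc1.le, hc2.le⟩, neg_pos.2 (lt_of_le_of_ne
      (newtonPoly_eval_nonpos_last hx _ ⟨hc1.le, hc2.le⟩) (newtonPoly_eval_ne_zero fun i hi => ?_))⟩
    rcases Nat.lt_succ_iff_lt_or_eq.1 hi with hi | rfl
    · exact ((hx.monotone (Nat.lt_succ_iff.1 hi)).trans_lt hc1).ne'
    · exact hc2.ne

/-- With `V` the primitive of `w_{2m+1}`, integration by parts turns the integral into `-∫ V`, the
boundary terms being zero; `V` is nonnegative and positive at the second node. -/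
theorem integral_newtonPoly_odd_neg (x₁ : ℝ) {h : ℝ} (hh : 0 < h) {m : ℕ} (hm : 0 < m) :
    ∫ t in (node x₁ h 0)..(node x₁ h (2 * m)), (newtonPoly (node x₁ h) (2 * m + 2)).eval t
      < 0 := by
  have hx := node_strictMono x₁ hh
  have hcw := continuous_newtonPoly_eval (node x₁ h) (2 * m + 1)
  have hlt : node x₁ h 0 < node x₁ h (2 * m) := hx (by omega)
  set V : ℝ → ℝ := fun y => ∫ t in (node x₁ h 0)..y, (newtonPoly (node x₁ h) (2 * m + 1)).eval t
    with hV
  have hVd : ∀ y, HasDerivAt V ((newtonPoly (node x₁ h) (2 * m + 1)).eval y) y := fun y =>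
    intervalIntegral.integral_hasDerivAt_right (hcw.intervalIntegrable _ _)
      (hcw.stronglyMeasurableAtFilter _ _) hcw.continuousAt
  have hparts := intervalIntegral.integral_mul_deriv_eq_deriv_mul
    (a := node x₁ h 0) (b := node x₁ h (2 * m)) (u := fun t => t - node x₁ h (2 * m + 1))
    (u' := fun _ => 1) (v := V) (v' := fun t => (newtonPoly (node x₁ h) (2 * m + 1)).eval t)
    (fun t _ => (hasDerivAt_id t).sub_const _) (fun t _ => hVd t) (by simp)
    (hcw.intervalIntegrable _ _)
  have hVb : V (node x₁ h (2 * m)) = 0 := integral_newtonPoly_eq_zero x₁ hh m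
  have hVa : V (node x₁ h 0) = 0 := intervalIntegral.integral_same
  have hpos : 0 < ∫ t in (node x₁ h 0)..(node x₁ h (2 * m)), V t :=
    intervalIntegral.integral_pos hlt
      (continuous_iff_continuousAt.2 fun y => (hVd y).continuousAt).continuousOn
      (fun y hy => integral_newtonPoly_nonneg x₁ hh m ⟨hy.1.le, hy.2⟩)
      ⟨node x₁ h 1, ⟨hx.monotone (by omega), hx.monotone (by omega)⟩,
        integral_newtonPoly_first_step_pos x₁ hh m⟩
  have heq : ∫ t in (node x₁ h 0)..(node x₁ h (2 * m)),
      (newtonPoly (node x₁ h) (2 * m + 2)).eval t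
      = ∫ t in (node x₁ h 0)..(node x₁ h (2 * m)),
        (t - node x₁ h (2 * m + 1)) * (newtonPoly (node x₁ h) (2 * m + 1)).eval t := by
    refine intervalIntegral.integral_congr fun t _ => ?_
    simp [newtonPoly, mul_comm]
  rw [heq, hparts, hVa, hVb]
  simp only [one_mul]
  linarith

/-! ### From the sign statement to the mean value formula -/

/-- If functions vanishing at the nodes with nonnegative `N`-th derivative have nonpositive
integral, every function vanishing at the nodes satisfies a mean value formula. -/
theorem exists_integral_eq_of_nonpos {a b : ℝ} (hab : a < b) {x : ℕ → ℝ} {n N : ℕ} (hnN : n ≤ N)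
    {c d : ℝ} (hc : c ∈ Set.Icc a b) (hd : d ∈ Set.Icc a b)
    (hpos : ∀ r : ℝ → ℝ, ContDiffOn ℝ N r (Set.Icc a b) → (∀ i < n, r (x i) = 0) →
      (∀ t ∈ Set.Icc a b, 0 ≤ iteratedDerivWithin N r (Set.Icc a b) t) → ∫ t in c..d, r t ≤ 0)
    {r : ℝ → ℝ} (hr : ContDiffOn ℝ N r (Set.Icc a b)) (hr0 : ∀ i < n, r (x i) = 0) :
    ∃ ξ ∈ Set.Icc a b, ∫ t in c..d, r t
      = (∫ t in c..d, (newtonPoly x N).eval t) / (N.factorial : ℝ)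
        * iteratedDerivWithin N r (Set.Icc a b) ξ := by
  have hu := uniqueDiffOn_Icc hab
  have hfac : (N.factorial : ℝ) ≠ 0 := by positivity
  have hcont := hr.continuousOn_iteratedDerivWithin le_rfl hu
  have hne : (Set.Icc a b).Nonempty := Set.nonempty_Icc.2 hab.le
  obtain ⟨ξ₁, hξ₁, hmin⟩ := isCompact_Icc.exists_isMinOn hne hcont
  obtain ⟨ξ₂, hξ₂, hmax⟩ := isCompact_Icc.exists_isMaxOn hne hcont
  have hw : ContDiff ℝ N fun t => (newtonPoly x N).eval t := by
    simpa using (newtonPoly x N).contDiff_aeval (𝕜 := ℝ) N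
  have hwD : ∀ t ∈ Set.Icc a b,
      iteratedDerivWithin N (fun t => (newtonPoly x N).eval t) (Set.Icc a b) t
        = N.factorial := by
    intro t ht
    rw [iteratedDerivWithin_polynomial_eval hab _ _ ht,
      eval_iterate_derivative_of_natDegree_le (newtonPoly_natDegree x N).le,
      newtonPoly_coeff_self, mul_one]
  have hir : IntervalIntegrable r volume c d :=
    (hr.continuousOn.mono (Set.uIcc_subset_Icc hc hd)).intervalIntegrable
  have hiw : ∀ μ : ℝ, IntervalIntegrable (fun t => μ * (newtonPoly x N).eval t) volume c d :=
    fun μ => (((newtonPoly x N).continuous).intervalIntegrable c d).const_mul μ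
  have hμC : ∀ μ : ℝ, ContDiff ℝ N fun t => μ * (newtonPoly x N).eval t :=
    fun μ => contDiff_const.mul hw
  have hμD : ∀ μ : ℝ, ∀ t ∈ Set.Icc a b,
      iteratedDerivWithin N (fun t => μ * (newtonPoly x N).eval t) (Set.Icc a b) t
        = μ * N.factorial := by
    intro μ t ht
    rw [iteratedDerivWithin_const_mul ht hu μ hw.contDiffAt.contDiffWithinAt, hwD t ht]
  set D := iteratedDerivWithin N r (Set.Icc a b) with hD
  have h1 := hpos (r - fun t => D ξ₁ / N.factorial * (newtonPoly x N).eval t)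
    (hr.sub (hμC _).contDiffOn)
    (fun i hi => by simp [hr0 i hi, newtonPoly_eval_node x (hi.trans_le hnN)])
    (fun t ht => by
      rw [iteratedDerivWithin_sub ht hu (hr _ ht) (hμC _).contDiffAt.contDiffWithinAt,
        hμD _ t ht, div_mul_cancel₀ _ hfac, sub_nonneg]
      exact hmin ht)
  have h2 := hpos ((fun t => D ξ₂ / N.factorial * (newtonPoly x N).eval t) - r)
    ((hμC _).contDiffOn.sub hr)
    (fun i hi => by simp [hr0 i hi, newtonPoly_eval_node x (hi.trans_le hnN)])
    (fun t ht => by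
      rw [iteratedDerivWithin_sub ht hu (hμC _).contDiffAt.contDiffWithinAt (hr _ ht),
        hμD _ t ht, div_mul_cancel₀ _ hfac, sub_nonneg]
      exact hmax ht)
  simp only [Pi.sub_apply] at h1 h2
  rw [intervalIntegral.integral_sub hir (hiw _), intervalIntegral.integral_const_mul] at h1
  rw [intervalIntegral.integral_sub (hiw _) hir, intervalIntegral.integral_const_mul] at h2
  set c' := ∫ t in c..d, (newtonPoly x N).eval t with hc'
  -- `h1` bounds the integral above by the value at the minimum `ξ₁` of `D`, and `h2` below by the
  -- value at the maximum `ξ₂`: the order is reversed.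
  have himg := isPreconnected_Icc.intermediate_value hξ₂ hξ₁
    (f := fun ξ => c' / N.factorial * D ξ) (continuousOn_const.mul hcont)
  have e1 : c' / N.factorial * D ξ₁ = D ξ₁ / N.factorial * c' := by ring
  have e2 : c' / N.factorial * D ξ₂ = D ξ₂ / N.factorial * c' := by ring
  obtain ⟨ξ, hξ, h⟩ := himg (show (∫ t in c..d, r t) ∈ _ from
    ⟨by simp only [e2]; linarith, by simp only [e1]; linarith⟩)
  exact ⟨ξ, hξ, h.symm⟩

/-! ### Degree of precision and error of the rules -/

theorem dividedDiff_congr {x : ℕ → ℝ} {f g : ℝ → ℝ} (k : ℕ) :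
    ∀ i, (∀ j, i ≤ j → j ≤ i + k → f (x j) = g (x j)) →
      dividedDiff x f k i = dividedDiff x g k i := by
  induction k with
  | zero => intro i h; exact h i le_rfl le_rfl
  | succ k ih =>
    intro i h
    rw [dividedDiff, dividedDiff, ih i fun j h1 h2 => h j h1 (by omega),
      ih (i + 1) fun j h1 h2 => h j (by omega) (by omega)]

/-- The only place where the form of the two models matters: it allows `f` to be replaced by its
interpolant inside `S`. -/
theorem rule_congr {n : ℕ} (hn : 2 ≤ n) {x : ℕ → ℝ} {S : (ℝ → ℝ) → ℝ}
    (hS : IsModelA n x S ∨ IsModelB n x S) {f g : ℝ → ℝ} (h : ∀ i < n, f (x i) = g (x i)) :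
    S f = S g := by
  have hdd : ∀ k < n, dividedDiff x f k 0 = dividedDiff x g k 0 := fun k hk =>
    dividedDiff_congr k 0 fun j _ hj => h j (by omega)
  rcases hS with ⟨⟨w, hw⟩, -⟩ | ⟨⟨w, hw⟩, -⟩
  · rw [hw, hw]
    exact Finset.sum_congr rfl fun j hj => by rw [hdd j (Finset.mem_range.1 hj)]
  · rw [hw, hw, hdd (n - 1) (by omega)]
    congr 1
    exact Finset.sum_congr rfl fun j hj => by
      rw [h j (by have := Finset.mem_range.1 hj; omega)]

/-- The degree of precision and the error term of a rule that integrates the interpolation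
polynomial, given the sign of the error on functions with nonnegative `N`-th derivative. -/
theorem degree_and_error {n N : ℕ} (hn : 2 ≤ n) (hnN : n ≤ N) {a b : ℝ} {x : ℕ → ℝ}
    (hx : StrictMono x) (hxI : ∀ i < n, x i ∈ Set.Icc a b) {S : (ℝ → ℝ) → ℝ}
    (hS : IsModelA n x S ∨ IsModelB n x S)
    (hpos : ∀ r : ℝ → ℝ, ContDiffOn ℝ N r (Set.Icc a b) → (∀ i < n, r (x i) = 0) →
      (∀ t ∈ Set.Icc a b, 0 ≤ iteratedDerivWithin N r (Set.Icc a b) t) →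
        ∫ t in (x 0)..(x (n - 1)), r t ≤ 0)
    (hneg : ∫ t in (x 0)..(x (n - 1)), (newtonPoly x N).eval t < 0) :
    HasDegreeOfPrecision n x S (N - 1) ∧
      ∀ f : ℝ → ℝ, ContDiffOn ℝ N f (Set.Icc a b) →
        ∃ ξ ∈ Set.Icc a b,
          panelIntegral n x f - S f =
            panelIntegral n x (fun t => (newtonPoly x N).eval t) / (Nat.factorial N : ℝ) *
              iteratedDerivWithin N f (Set.Icc a b) ξ := by
  have h0 := hxI 0 (by omega)
  have h1 := hxI (n - 1) (by omega)
  have hab : a < b := h0.1.trans_lt ((hx (by omega : 0 < n - 1)).trans_le h1.2)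
  have hu := uniqueDiffOn_Icc hab
  have hexact : ExactUpTo n x S (n - 1) := hS.elim (fun h => h.2) fun h => h.2
  have herr : ∀ f : ℝ → ℝ, ContDiffOn ℝ N f (Set.Icc a b) →
        ∃ ξ ∈ Set.Icc a b,
          panelIntegral n x f - S f =
            panelIntegral n x (fun t => (newtonPoly x N).eval t) / (Nat.factorial N : ℝ) *
              iteratedDerivWithin N f (Set.Icc a b) ξ := by
    intro f hf
    have hinj : Set.InjOn x (Finset.range n : Set ℕ) := hx.injective.injOn
    set p := Lagrange.interpolate (Finset.range n) x (fun i => f (x i)) with hp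
    have hpx : ∀ i < n, p.eval (x i) = f (x i) := fun i hi =>
      Lagrange.eval_interpolate_at_node _ hinj (Finset.mem_range.2 hi)
    have hpd : p.natDegree ≤ n - 1 := by
      refine natDegree_le_of_degree_le ?_
      have := Lagrange.degree_interpolate_le (fun i => f (x i)) hinj
      rwa [Finset.card_range] at this
    have hpC : ContDiff ℝ N fun t => p.eval t := by
      simpa using p.contDiff_aeval (𝕜 := ℝ) N
    obtain ⟨ξ, hξ, h⟩ := exists_integral_eq_of_nonpos hab hnN h0 h1 hpos
      (r := f - fun t => p.eval t) (hf.sub hpC.contDiffOn) (fun i hi => by simp [hpx i hi])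
    refine ⟨ξ, hξ, ?_⟩
    rw [iteratedDerivWithin_sub hξ hu (hf _ hξ) hpC.contDiffAt.contDiffWithinAt,
      iteratedDerivWithin_polynomial_eval hab _ _ hξ,
      iterate_derivative_eq_zero (by omega), eval_zero, sub_zero] at h
    simp only [Pi.sub_apply] at h
    rw [intervalIntegral.integral_sub
      (hf.continuousOn.mono (Set.uIcc_subset_Icc h0 h1)).intervalIntegrable
      (p.continuous.intervalIntegrable _ _)] at h
    rw [rule_congr hn hS (g := fun t => p.eval t) fun i hi => (hpx i hi).symm, ← hexact p hpd]
    exact h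
  refine ⟨⟨fun p hp => ?_, fun m hm => ?_⟩, herr⟩
  · obtain ⟨ξ, hξ, h⟩ := herr (fun t => p.eval t)
      (by simpa using (p.contDiff_aeval (𝕜 := ℝ) N).contDiffOn)
    rw [iteratedDerivWithin_polynomial_eval hab _ _ hξ,
      iterate_derivative_eq_zero (by omega), eval_zero, mul_zero] at h
    linarith
  -- Exactness beyond degree `N - 1` would include `w_N`, which the rule cannot tell from `0` since
  -- it vanishes at the nodes; yet its integral is negative.
  · by_contra hlt
    have e1 := hm (newtonPoly x N) (by rw [newtonPoly_natDegree]; omega)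
    have e2 := hm 0 (by simp)
    rw [rule_congr hn hS (g := fun t => (0 : ℝ[X]).eval t) fun i hi => by
      simp [newtonPoly_eval_node x (hi.trans_le hnN)], ← e2] at e1
    simp only [panelIntegral, eval_zero, intervalIntegral.integral_zero] at e1
    exact hneg.ne e1

theorem proposition2p5 (n : ℕ) (hn : 2 ≤ n) (x₁ h a b : ℝ) (hh : 0 < h)
    (hpanel : ∀ i < n, node x₁ h i ∈ Set.Icc a b)
    (S : (ℝ → ℝ) → ℝ) (hS : IsModelA n (node x₁ h) S ∨ IsModelB n (node x₁ h) S) :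
    (Odd n →
      HasDegreeOfPrecision n (node x₁ h) S n ∧
      ∀ f : ℝ → ℝ, ContDiffOn ℝ (n + 1 : ℕ) f (Set.Icc a b) →
        ∃ ξ ∈ Set.Icc a b,
          panelIntegral n (node x₁ h) f - S f =
            panelIntegral n (node x₁ h) (fun t => (newtonPoly (node x₁ h) (n + 1)).eval t) /
                (Nat.factorial (n + 1) : ℝ) *
              iteratedDerivWithin (n + 1) f (Set.Icc a b) ξ) ∧
    (Even n →
      HasDegreeOfPrecision n (node x₁ h) S (n - 1) ∧
      ∀ f : ℝ → ℝ, ContDiffOn ℝ n f (Set.Icc a b) →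
        ∃ ξ ∈ Set.Icc a b,
          panelIntegral n (node x₁ h) f - S f =
            panelIntegral n (node x₁ h) (fun t => (newtonPoly (node x₁ h) n).eval t) /
                (Nat.factorial n : ℝ) *
              iteratedDerivWithin n f (Set.Icc a b) ξ) := by
  have hx := node_strictMono x₁ hh
  have h0 := hpanel 0 (by omega)
  have h1 := hpanel (n - 1) (by omega)
  have hab : a < b := h0.1.trans_lt ((hx (by omega : 0 < n - 1)).trans_le h1.2)
  constructor
  · rintro ⟨m, rfl⟩
    -- Here `N = n + 1`: the derivative order exceeds the number of nodes by one. The bound `2 ≤ n`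
    -- forces `0 < m`, as the strict sign requires.
    exact degree_and_error (N := 2 * m + 2) hn (by omega) hx hpanel hS
      (fun r hr hr0 hD => integral_nonpos_of_odd_nodes hab x₁ hh m hpanel hr hr0 hD)
      (integral_newtonPoly_odd_neg x₁ hh (by omega))
  · intro he
    obtain ⟨m, rfl⟩ : ∃ m, n = 2 * m + 2 := by
      obtain ⟨k, rfl⟩ := he
      exact ⟨k - 1, by omega⟩
    exact degree_and_error (N := 2 * m + 2) hn le_rfl hx hpanel hS
      (fun r hr hr0 hD => integral_nonpos_of_even_nodes hab x₁ hh m hpanel hr hr0 hD)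
      (integral_newtonPoly_even_neg x₁ hh m)
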